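/- Let $G \overset{q}{\to} F \overset{p}{\to} B$ be a smooth double fibred manifold: $B \neq \emptyset$, $F$, $G$ are finite-dimensional smooth manifolds and $p$, $q$ are smooth surjective submersions. Write $F_b = p^{-1}(b)$, $G_b = (p\circ q)^{-1}(b)$. An \emph{F--smooth space} is a non-empty set $X$ with a family of \emph{basic curves} $c : I \to X$ ($I \subset \mathbb{R}$ open) such that some basic curve passes through every point, and $c\circ\gamma$ is basic whenever $c : I \to X$ is basic and $\gamma : J \to I$ is smooth with $J\subset\mathbb{R}$ open. A map defined on a subset $U$ of an F--smooth space, with values in an F--smooth space, is \emph{F--smooth} if it sends every basic curve with values in $U$ to a basic curve. A smooth manifold is an F--smooth space whose basic curves are its smooth curves. An \emph{F--smooth system of fibrewisely smooth sections} $(S,\zeta,\epsilon)$ of $G\to F\to B$ consists of a set $S$, a surjective map $\zeta : S \to B$ and a map $\epsilon : S\times_B F \to G$ with $q(\epsilon(s,f)) = f$, such that for each $b \in B$ and $s\in\zeta^{-1}(b)$ the map $\epsilon(s,\cdot) : F_b \to G_b$ is smooth. Then $S$ is an F--smooth space: a curve $\hat c : I \to S$ is basic if both $c = \zeta\circ\hat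 c : I \to B$ and the map $c^*(F) = \{(\lambda,f)\in I\times F : c(\lambda)=p(f)\} \to G$, $(\lambda,f)\mapsto \epsilon(\hat c(\lambda),f)$, are smooth. For $U\subset B$ open, a local section $\sigma : U \to S$ of $\zeta$ (with no smoothness requirement) induces the tubelike section $\bar\sigma = \epsilon_S(\sigma) : p^{-1}(U)\to G$, $\bar\sigma(f) = \epsilon(\sigma(p(f)),f)$, of $q$, which is smooth on each fibre $F_b$, $b\in U$. The system is \emph{injective} if, over each open $U$, $\bar\sigma=\bar\sigma'$ implies $\sigma=\sigma'$. Let $\mathcal{F}(U)$ be the set of F--smooth sections $\sigma : U\to S$, and let $\mathcal{T}_S(U)$ be the set of smooth sections $p^{-1}(U)\to G$ of $q$ that are of the form $\bar\sigma$ for some section $\sigma : U \to S$. \textbf{Theorem.} Let $(S,\zeta,\epsilon)$ be an F--smooth system of fibrewisely smooth sections of $G\to F\to B$. (1) For every open $U \subset B$ and every local section $\sigma : U\to S$, the induced tubelike section $\bar\sigma : p^{-1}(U)\to G$ is smooth if and only if $\sigma$ is F--smooth. (2) $\mathcal{F}$ and $\mathcal{T}_S$ are sheaves on $B$, and $\epsilon_S$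 restricts to a morphism of sheaves $\mathcal{F}\to\mathcal{T}_S$ which is surjective on the sections over every open $U\subset B$. If the system is injective, this morphism is an isomorphism of sheaves. -/

import Mathlib

open scoped Manifold ContDiff
open TopologicalSpace CategoryTheory Opposite

universe u

namespace FSys

/-! ### F-smooth spaces and F-smooth maps -/

/-- An F-smooth space (in the sense of Frölicher, without the duality axiom): a non-empty set `X`
with a family of *basic curves* `c : I → X`, with `I ⊆ ℝ` open, such that some basic curve passes
through each point and the family is closed under smooth reparametrisations. -/
structure FSmoothSpace (X : Type*) where
  nonempty : Nonempty X
  basic : ∀ I : Opens ℝ, Set (I → X)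
  covers : ∀ x : X, ∃ I : Opens ℝ, ∃ c ∈ basic I, ∃ t : I, c t = x
  reparam : ∀ (I J : Opens ℝ) (c : I → X), c ∈ basic I →
    ∀ γ : J → I, ContMDiff 𝓘(ℝ, ℝ) 𝓘(ℝ, ℝ) ∞ γ → c ∘ γ ∈ basic J

/-- A map `f`, defined on a subset `U` of an F-smooth space, with values in an F-smooth space, is
F-smooth if it maps the basic curves with values in `U` to basic curves. -/
def FSmoothOn {X Y : Type*} (C : FSmoothSpace X) (C' : FSmoothSpace Y) (U : Set X) (f : U → Y) :
    Prop :=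
  ∀ (I : Opens ℝ) (c : I → X), c ∈ C.basic I → ∀ h : ∀ t, c t ∈ U,
    (fun t : I => f ⟨c t, h t⟩) ∈ C'.basic I

section Manifolds

variable {E H M : Type*} [NormedAddCommGroup E] [NormedSpace ℝ E] [TopologicalSpace H]
  (I : ModelWithCorners ℝ E H) [TopologicalSpace M] [ChartedSpace H M]
  {E' H' N : Type*} [NormedAddCommGroup E'] [NormedSpace ℝ E'] [TopologicalSpace H']
  (I' : ModelWithCorners ℝ E' H') [TopologicalSpace N] [ChartedSpace H' N]

/-- The natural F-smooth structure of a smooth manifold: the basic curves are the smooth ones. -/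
def naturalFSmooth (M : Type*) [TopologicalSpace M] [ChartedSpace H M] [hM : Nonempty M] :
    FSmoothSpace M where
  nonempty := hM
  basic _ := {c | ContMDiff 𝓘(ℝ, ℝ) I ∞ c}
  covers x := ⟨⊤, fun _ => x, contMDiff_const, ⟨0, trivial⟩, rfl⟩
  reparam _ _ _ hc _ hγ := ContMDiff.comp hc hγ

/-- Smoothness of a map `g : A → N` defined on a subset `A` of a manifold `M`: near each point of
`A` the map `g` is the restriction of a smooth map defined on an open subset of `M`. When `A` is an
embedded submanifold of `M`, this is smoothness for the induced manifold structure of `A` (and it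
does not change when `N` is replaced by an embedded submanifold containing the values of `g`).
Below it is used only for embedded submanifolds: fibres of submersions and pullbacks of submersions
along smooth curves. -/
def SmoothOnSubmanifold (A : Set M) (g : A → N) : Prop :=
  ∀ x : A, ∃ W : Set M, IsOpen W ∧ (x : M) ∈ W ∧ ∃ g' : M → N,
    ContMDiffOn I I' ∞ g' W ∧ ∀ y : A, (y : M) ∈ W → g' y = g y

/-- A smooth fibred manifold `M → N`: a smooth surjective submersion. -/
structure FibredManifold (M N : Type*) [TopologicalSpace M] [ChartedSpace H M]
    [TopologicalSpace N] [ChartedSpace H' N] where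
  toFun : M → N
  isSubmersion : Manifold.IsSubmersion I I' ∞ toFun
  surjective : Function.Surjective toFun

instance : CoeFun (FibredManifold I I' M N) (fun _ => M → N) := ⟨FibredManifold.toFun⟩

variable {I I'}

/-- The tubelike open subset `p⁻¹(U)` of the total space over an open subset `U` of the base. -/
def FibredManifold.tube [IsManifold I ∞ M] [IsManifold I' ∞ N]
    (p : FibredManifold I I' M N) (U : Opens N) : Opens M :=
  ⟨p ⁻¹' U, U.isOpen.preimage p.isSubmersion.contMDiff.continuous⟩

end Manifolds

/-! ### F-smooth systems of fibrewisely smooth sections -/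

section Systems

variable {EB HB EF HF EG HG : Type*}
  [NormedAddCommGroup EB] [NormedSpace ℝ EB] [TopologicalSpace HB]
  [NormedAddCommGroup EF] [NormedSpace ℝ EF] [TopologicalSpace HF]
  [NormedAddCommGroup EG] [NormedSpace ℝ EG] [TopologicalSpace HG]
  {IB : ModelWithCorners ℝ EB HB} {IF : ModelWithCorners ℝ EF HF}
  {IG : ModelWithCorners ℝ EG HG}
  {B F G : Type u}
  [TopologicalSpace B] [ChartedSpace HB B] [IsManifold IB ∞ B]
  [TopologicalSpace F] [ChartedSpace HF F] [IsManifold IF ∞ F]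
  [TopologicalSpace G] [ChartedSpace HG G] [IsManifold IG ∞ G]

/-- An F-smooth system `(S, ζ, ε)` of fibrewisely smooth sections of the smooth double fibred
manifold `G → F → B` with projections `q` and `p`. Here `S` is just a set, and the evaluation map
`ε` is defined on the fibred product of `S` and `F` over `B`. -/
structure FSmoothSystem (p : FibredManifold IF IB F B) (q : FibredManifold IG IF G F)
    (S : Type u) where
  ζ : S → B
  ζ_surjective : Function.Surjective ζ
  ε : {x : S × F // ζ x.1 = p x.2} → G
  q_ε : ∀ x, q (ε x) = x.1.2
  fibrewise_smooth : ∀ s : S, SmoothOnSubmanifold IF IG (p ⁻¹' {ζ s})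
    (fun f => ε ⟨(s, f), Eq.symm f.2⟩)

/-- The presheaf on `B` whose sections over `U` are the tubelike fibrewisely smooth sections
`φ : p⁻¹(U) → G` of `q`: the restriction of `φ` to each fibre `F_b`, with `b ∈ U`, is smooth, with
no further smoothness requirement. -/
def uTub (p : FibredManifold IF IB F B) (q : FibredManifold IG IF G F) :
    TopCat.Presheaf (Type u) (TopCat.of B) where
  obj U := {φ : p.tube (unop U : Opens B) → G //
    (∀ f, q (φ f) = f) ∧
    ∀ (b : B) (hb : b ∈ (unop U : Opens B)), SmoothOnSubmanifold IF IG (p ⁻¹' {b})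
      (fun f => φ ⟨f, by have h : p f = b := f.2; change p f ∈ (unop U : Opens B); rwa [h]⟩)}
  map i := ↾fun φ => ⟨fun f => φ.1 ⟨f, i.unop.le f.2⟩,
    fun f => φ.2.1 ⟨f, i.unop.le f.2⟩, fun b hb => φ.2.2 b (i.unop.le hb)⟩

/-- The tubelike smooth sections `φ : p⁻¹(U) → G` of `q` (smooth on the open submanifold `p⁻¹(U)`
of `F`), as a subpresheaf of the tubelike fibrewisely smooth sections. -/
def tub (p : FibredManifold IF IB F B) (q : FibredManifold IG IF G F) :
    Subfunctor (uTub p q) where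
  obj U := {φ | ContMDiff IF IG ∞ φ.1}
  map {U V} i φ hφ := by
    have h : p.tube (unop V : Opens B) ≤ p.tube (unop U : Opens B) := fun _ hf => i.unop.le hf
    have hφ' : ContMDiff IF IG ∞ φ.1 := hφ
    exact hφ'.comp (contMDiff_inclusion h)

namespace FSmoothSystem

variable {p : FibredManifold IF IB F B} {q : FibredManifold IG IF G F} {S : Type u}
  (sys : FSmoothSystem p q S)

/-- The presheaf on `B` of local sections of `ζ : S → B`, without any smoothness requirement. -/
def uSec : TopCat.Presheaf (Type u) (TopCat.of B) where
  obj U := {σ : ↥(unop U : Opens B) → S // ∀ b, sys.ζ (σ b) = b}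
  map i := ↾fun σ => ⟨fun b => σ.1 ⟨b, i.unop.le b.2⟩, fun b => σ.2 ⟨b, i.unop.le b.2⟩⟩

/-- The morphism `σ ↦ ε(σ, ·)` from local sections of `ζ` to tubelike fibrewisely smooth sections
of `q`: a section `σ` over `U` is sent to `p⁻¹(U) → G, f ↦ ε(σ(p(f)), f)`. -/
def evalS : sys.uSec ⟶ uTub p q where
  app U := ↾fun σ => ⟨fun f => sys.ε ⟨(σ.1 ⟨p f, f.2⟩, f), σ.2 ⟨p f, f.2⟩⟩,
    fun f => sys.q_ε _, fun b hb => by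
      have h := sys.fibrewise_smooth (σ.1 ⟨b, hb⟩)
      have e : sys.ζ (σ.1 ⟨b, hb⟩) = b := σ.2 ⟨b, hb⟩
      intro x
      obtain ⟨W, hW, hxW, g', hg', hgg⟩ := h ⟨x, by rw [e]; exact x.2⟩
      refine ⟨W, hW, hxW, g', hg', fun y hy => ?_⟩
      obtain ⟨y, rfl⟩ := y
      exact hgg ⟨y, e.symm⟩ hy⟩

/-- The presheaf of the tubelike fibrewisely smooth sections which are selected by the system. -/
def uTubS : Subfunctor (uTub p q) := Subfunctor.range sys.evalS

/-- The presheaf of the tubelike smooth sections which are selected by the system. -/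
def tubS : Subfunctor (uTub p q) := sys.uTubS ⊓ tub p q

/-- The system is injective if a local section of `ζ` is determined by the induced tubelike
section. -/
def Injective : Prop :=
  ∀ (U : Opens B), Function.Injective (sys.evalS.app (op U))

/-- The pullback `c^*(F) = {(t, f) ∈ I × F | c(t) = p(f)}` of `F` along a curve `c : I → B`, a
submanifold of `I × F` when `c` is smooth. -/
def pullback (p : FibredManifold IF IB F B) {I : Opens ℝ} (c : I → B) : Set (I × F) :=
  {x | c x.1 = p x.2}

/-- For a curve `c : I → S`, the map `(ζ ∘ c)^*(F) → G, (t, f) ↦ ε(c(t), f)`. -/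
def pullbackEval {I : Opens ℝ} (c : I → S) (x : pullback p (sys.ζ ∘ c)) : G :=
  sys.ε ⟨(c x.1.1, x.1.2), x.2⟩

/-- The natural F-smooth structure of `S`: a curve `c : I → S` is basic if both the curve
`ζ ∘ c : I → B` and the induced map `(ζ ∘ c)^*(F) → G` are smooth. -/
def fSmoothSpace [hB : Nonempty B] : FSmoothSpace S where
  nonempty := (sys.ζ_surjective hB.some).nonempty
  basic I := {c | ContMDiff 𝓘(ℝ, ℝ) IB ∞ (sys.ζ ∘ c) ∧
    SmoothOnSubmanifold (𝓘(ℝ, ℝ).prod IF) IG (pullback p (sys.ζ ∘ c)) (sys.pullbackEval c)}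
  covers s := by
    refine ⟨⊤, fun _ => s, ⟨contMDiff_const, ?_⟩, ⟨0, trivial⟩, rfl⟩
    rintro ⟨⟨t, f⟩, hx⟩
    obtain ⟨W, hW, hxW, g', hg', hgg⟩ := sys.fibrewise_smooth s ⟨f, Eq.symm hx⟩
    refine ⟨Prod.snd ⁻¹' W, hW.preimage continuous_snd, hxW, g' ∘ Prod.snd,
      hg'.comp contMDiffOn_snd (fun _ h => h), ?_⟩
    rintro ⟨⟨t', f'⟩, hy⟩ hyW
    exact hgg ⟨f', Eq.symm hy⟩ hyW
  reparam I J c hc γ hγ := by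
    refine ⟨hc.1.comp hγ, ?_⟩
    rintro ⟨⟨t, f⟩, hx⟩
    obtain ⟨W, hW, hxW, g', hg', hgg⟩ := hc.2 ⟨(γ t, f), hx⟩
    have hm : ContMDiff (𝓘(ℝ, ℝ).prod IF) (𝓘(ℝ, ℝ).prod IF) ∞
        (Prod.map γ (id : F → F)) := hγ.prodMap contMDiff_id
    refine ⟨Prod.map γ id ⁻¹' W, hW.preimage hm.continuous, hxW, g' ∘ Prod.map γ id,
      hg'.comp hm.contMDiffOn (fun _ h => h), ?_⟩
    rintro ⟨⟨t', f'⟩, hy⟩ hyW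
    exact hgg ⟨(γ t', f'), hy⟩ hyW

/-- A local section `σ : U → S` is F-smooth, for the natural F-smooth structures of `B` and `S`. -/
def IsFSmooth [Nonempty B] {U : Opens B} (σ : sys.uSec.obj (op U)) : Prop :=
  FSmoothOn (naturalFSmooth IB B) sys.fSmoothSpace (U : Set B) σ.1

/-- The presheaf of F-smooth local sections of `ζ : S → B`. -/
def fSec [Nonempty B] : Subfunctor sys.uSec where
  obj U := {σ | sys.IsFSmooth (U := unop U) σ}
  map i _ hσ J c hc h := hσ J c hc (fun t => i.unop.le (h t))

end FSmoothSystem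

end Systems

end FSys

/-!
The heart of the matter is the first assertion, and there the direction from F-smooth sections to
smooth tubelike sections. Let `σ` be F-smooth and let `σ̄ f = ε (σ (p f), f)` be the induced tubelike
section. Along a smooth curve `γ` in `p⁻¹(U)`, the curve `σ ∘ p ∘ γ` is basic, hence `σ̄ ∘ γ` is the
composition of the smooth curve `t ↦ (t, γ t)` in the pullback of `F` along `p ∘ γ` with a smooth
map. So `σ̄` sends smooth curves to smooth curves, and by Boman's theorem it is smooth
(`contMDiff_of_comp_curve`, `contMDiff_of_isFSmooth`). Conversely, if `σ̄` is smooth then along a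
curve the evaluation map is the restriction of `(t, f) ↦ σ̄ f`.

Boman's theorem is proved in two steps. First, a smooth curve can be laid through suitably fast
converging points with prescribed small velocities (`exists_times_tolerances`). Therefore a map
which is smooth along smooth curves is continuous, and its directional derivatives of each order are
locally bounded, uniformly in the direction: a sequence of points where they explode would lie on a
smooth curve whose composition with the map has an unbounded derivative on a compact interval
(`continuousAt_of_comp_curve`, `eventually_norm_iteratedDeriv_line_le`). Secondly, after
multiplication by a bump function, bounded directional derivatives of order `n` imply that the
Fourier transform is `O(‖w‖⁻ⁿ)`; this is seen with iterated differences, which avoids any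
regularity of the directional derivatives as functions of the point. A continuous function with
rapidly decreasing Fourier transform is smooth, by Fourier inversion
(`exists_pow_norm_mul_norm_fourier_le`, `contDiff_of_bounded_iteratedDeriv_line`).

The sheaf conditions follow from the locality of smoothness on `p⁻¹(U)`; by the first assertion this
also gives the locality of F-smoothness. In gluing selected tubelike sections one uses that the
selecting sections of `ζ` need not be smooth, so that they can be chosen point by point
(`isSheaf_tubS`). The morphism induced by `ε` is surjective on sections by the first assertion, and
bijective if the system is injective.
-/

namespace FSys

open Filter Topology

/-! ### Smooth curves through rapidly converging sequences -/

section Curves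

variable {V W : Type*} [NormedAddCommGroup V] [NormedSpace ℝ V]
  [NormedAddCommGroup W] [NormedSpace ℝ W]

theorem norm_iteratedFDeriv_smul_const_le {a : ℝ → ℝ} (ha : ContDiff ℝ ∞ a) (y : V) (i : ℕ)
    (t : ℝ) : ‖iteratedFDeriv ℝ i (fun s => a s • y) t‖ ≤ ‖y‖ * ‖iteratedFDeriv ℝ i a t‖ := by
  have h := (ContinuousLinearMap.toSpanSingleton ℝ y).iteratedFDeriv_comp_left
    (ha.contDiffAt (x := t)) (i := i) (by exact_mod_cast le_top)
  have e : (fun s => a s • y) = (ContinuousLinearMap.toSpanSingleton ℝ y) ∘ a := by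
    ext s; simp
  rw [e, h]
  refine (ContinuousLinearMap.norm_compContinuousMultilinearMap_le _ _).trans ?_
  rw [ContinuousLinearMap.norm_toSpanSingleton]

/-- Finitely many derivatives of a compactly supported smooth function have a common bound. -/
theorem exists_bound_iteratedFDeriv {a : ℝ → ℝ} (ha : ContDiff ℝ ∞ a) (hs : HasCompactSupport a)
    (k : ℕ) : ∃ C, ∀ i ≤ k, ∀ t, ‖iteratedFDeriv ℝ i a t‖ ≤ C := by
  have h (i : ℕ) : ∃ C, ∀ t, ‖iteratedFDeriv ℝ i a t‖ ≤ C :=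
    (hs.iteratedFDeriv i).exists_bound_of_continuous
      (ha.continuous_iteratedFDeriv (by exact_mod_cast le_top))
  choose C hC using h
  refine ⟨∑ i ∈ Finset.range (k + 1), |C i|, fun i hi t => (hC i t).trans ?_⟩
  exact (le_abs_self _).trans (Finset.single_le_sum (f := fun i => |C i|)
    (fun _ _ => abs_nonneg _) (Finset.mem_range.2 (Nat.lt_succ_of_le hi)))

/-- The *special curve lemma*: there are times `τ k → 0` and tolerances `δ k > 0` such that, for
all positions `y k` and velocities `w k` within the tolerances, some smooth curve which is at `0`
at the time `0` follows the line `y k + (t - τ k) • w k` for `t` near `τ k`. -/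
theorem exists_times_tolerances : ∃ τ δ : ℕ → ℝ, Tendsto τ atTop (𝓝 0) ∧ (∀ k, 0 < δ k) ∧
    ∀ {V : Type*} [NormedAddCommGroup V] [NormedSpace ℝ V] [CompleteSpace V] (y w : ℕ → V),
      (∀ k, ‖y k‖ ≤ δ k) → (∀ k, ‖w k‖ ≤ δ k) →
      ∃ c : ℝ → V, ContDiff ℝ ∞ c ∧ c 0 = 0 ∧
        ∀ k, ∀ᶠ t in 𝓝 (τ k), c t = y k + (t - τ k) • w k := by
  let τ : ℕ → ℝ := fun k => (1 / 2) ^ k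
  have hτ (k) : 0 < τ k := by positivity
  let ψ (k : ℕ) : ContDiffBump (τ k) :=
    ⟨τ k / 8, τ k / 4, by have := hτ k; positivity, by have := hτ k; linarith⟩
  have hψ0 (k : ℕ) (t : ℝ) (h : τ k / 4 ≤ |t - τ k|) : ψ k t = 0 :=
    (ψ k).zero_of_le_dist (by rw [Real.dist_eq]; exact h)
  have hτhalf {j k : ℕ} (hjk : j < k) : τ k ≤ τ j / 2 := by
    have h : τ k ≤ τ (j + 1) := pow_le_pow_of_le_one (by norm_num) (by norm_num) hjk
    have h' : τ (j + 1) = τ j / 2 := by simp only [τ, pow_succ]; ring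
    linarith
  -- The supports of the bump functions are disjoint: `ψ j` vanishes near `τ k` for `j ≠ k`.
  have hψne {j k : ℕ} (hjk : j ≠ k) {t : ℝ} (ht : |t - τ k| < τ k / 8) : ψ j t = 0 := by
    apply hψ0
    have hj := hτ j
    have hk := hτ k
    rcases lt_or_gt_of_ne hjk with h | h
    · have := hτhalf h
      rw [abs_lt] at ht
      rw [abs_of_neg (by linarith)]
      linarith
    · have := hτhalf h
      rw [abs_lt] at ht
      rw [abs_of_pos (by linarith)]
      linarith
  let a (k : ℕ) (t : ℝ) : ℝ := ψ k t
  let b (k : ℕ) (t : ℝ) : ℝ := ψ k t * (t - τ k)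
  have ha (k) : ContDiff ℝ ∞ (a k) := (ψ k).contDiff
  have hb (k) : ContDiff ℝ ∞ (b k) := (ψ k).contDiff.mul (contDiff_id.sub contDiff_const)
  have hA (k : ℕ) := exists_bound_iteratedFDeriv (ha k) (ψ k).hasCompactSupport k
  have hB (k : ℕ) := exists_bound_iteratedFDeriv (hb k) (ψ k).hasCompactSupport.mul_right k
  choose A hA using hA
  choose C hB using hB
  -- With the tolerance `(1 / 2) ^ k / M k`, the derivatives of order at most `k` of the `k`-th term
  -- of the series below are at most `2 * (1 / 2) ^ k`.
  let M (k : ℕ) : ℝ := 1 + |A k| + |C k|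
  have hM (k) : 0 < M k := by positivity
  refine ⟨τ, fun k => (1 / 2) ^ k / M k,
    tendsto_pow_atTop_nhds_zero_of_lt_one (by norm_num) (by norm_num),
    fun k => div_pos (hτ k) (hM k), ?_⟩
  intro V _ _ _ y w hy hw
  let g (k : ℕ) (t : ℝ) : V := a k t • y k + b k t • w k
  have hga (k) : ContDiff ℝ ∞ (fun t => a k t • y k) := (ha k).smul contDiff_const
  have hgb (k) : ContDiff ℝ ∞ (fun t => b k t • w k) := (hb k).smul contDiff_const
  have hg (k) : ContDiff ℝ ∞ (g k) := (hga k).add (hgb k)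
  refine ⟨fun t => ∑' k, g k t, ?_, ?_, ?_⟩
  · refine contDiff_tsum_of_eventually (v := fun _ k => 2 * (1 / 2 : ℝ) ^ k) hg
      (fun i _ => (summable_geometric_of_lt_one (by norm_num) (by norm_num)).mul_left 2) ?_
    intro i _
    rw [Nat.cofinite_eq_atTop]
    filter_upwards [eventually_ge_atTop i] with k hk t
    have e : iteratedFDeriv ℝ i (g k) t = iteratedFDeriv ℝ i (fun t => a k t • y k) t +
        iteratedFDeriv ℝ i (fun t => b k t • w k) t :=
      iteratedFDeriv_add_apply (((hga k).of_le (by exact_mod_cast le_top)).contDiffAt)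
        (((hgb k).of_le (by exact_mod_cast le_top)).contDiffAt)
    have key {x : V} {D : ℝ} (hx : ‖x‖ ≤ (1 / 2) ^ k / M k) (hD : D ≤ M k) :
        ‖x‖ * D ≤ (1 / 2) ^ k :=
      calc ‖x‖ * D ≤ ‖x‖ * M k := by gcongr
        _ ≤ (1 / 2) ^ k / M k * M k := by have := hM k; gcongr
        _ = (1 / 2) ^ k := div_mul_cancel₀ _ (hM k).ne'
    rw [e, two_mul]
    refine (norm_add_le _ _).trans (add_le_add ?_ ?_)
    · refine (norm_iteratedFDeriv_smul_const_le (ha k) _ i t).trans (key (hy k) ?_)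
      have := hA k i hk t
      have := le_abs_self (A k)
      have := abs_nonneg (C k)
      simp only [M]; linarith
    · refine (norm_iteratedFDeriv_smul_const_le (hb k) _ i t).trans (key (hw k) ?_)
      have := hB k i hk t
      have := le_abs_self (C k)
      have := abs_nonneg (A k)
      simp only [M]; linarith
  · have h (k) : g k 0 = 0 := by
      have h0 : ψ k 0 = 0 := hψ0 k 0 (by
        have := hτ k
        rw [zero_sub, abs_neg, abs_of_pos this]; linarith)
      simp [g, a, b, h0]
    simp [h]
  · intro k
    have hk := hτ k
    filter_upwards [Metric.ball_mem_nhds (τ k) (show 0 < τ k / 8 by positivity)] with t ht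
    rw [Metric.mem_ball, Real.dist_eq] at ht
    have h1 : ψ k t = 1 := (ψ k).one_of_mem_closedBall (by
      rw [Metric.mem_closedBall, Real.dist_eq]; exact ht.le)
    rw [tsum_eq_single k]
    · simp [g, a, b, h1]
    · intro j hj
      simp [g, a, b, hψne hj ht]

/-- A map on a normed space whose compositions with smooth curves are continuous is continuous. -/
theorem continuousAt_of_comp_curve [CompleteSpace V] {Y : Type*} [TopologicalSpace Y]
    {f : V → Y} {x : V}
    (hf : ∀ c : ℝ → V, ContDiff ℝ ∞ c → c 0 = x → ContinuousAt (f ∘ c) 0) : ContinuousAt f x := by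
  obtain ⟨τ, δ, hτ, hδ, H⟩ := exists_times_tolerances
  by_contra hcont
  obtain ⟨N, hN, hfN⟩ : ∃ N ∈ 𝓝 (f x), ¬ ∀ᶠ z in 𝓝 x, f z ∈ N := by
    by_contra! h
    exact hcont fun N hN => h N hN
  have hz (k : ℕ) : ∃ z, ‖z - x‖ ≤ δ k ∧ f z ∉ N := by
    by_contra! h
    refine hfN (Filter.mem_of_superset (Metric.ball_mem_nhds x (hδ k)) fun z hz => h z ?_)
    rw [← dist_eq_norm]
    exact (Metric.mem_ball.1 hz).le
  choose z hzx hzN using hz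
  obtain ⟨c, hc, hc0, hcz⟩ := H (fun k => z k - x) (fun _ => 0) hzx
    (fun k => by simpa using (hδ k).le)
  have h := (hf (fun t => x + c t) (contDiff_const.add hc) (by simp [hc0])).tendsto.comp hτ
  have h' : ∀ᶠ k in atTop, f (z k) ∈ N := by
    have e (k : ℕ) : x + c (τ k) = z k := by simp [(hcz k).self_of_nhds]
    have := h (by simpa [hc0] using hN)
    simpa [Function.comp_def, e] using this
  obtain ⟨k, hk⟩ := h'.exists
  exact hzN k hk

/-- The directional derivatives of any given order of a map which is smooth along smooth curves are
locally bounded, uniformly with respect to the direction. Otherwise a smooth curve runs with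
controlled velocity through points where these derivatives explode. -/
theorem eventually_norm_iteratedDeriv_line_le [CompleteSpace V] {f : V → W}
    (hf : ∀ c : ℝ → V, ContDiff ℝ ∞ c → ContDiff ℝ ∞ (f ∘ c)) (n : ℕ) (x : V) :
    ∃ C, ∀ᶠ y in 𝓝 x, ∀ v : V, ‖v‖ ≤ 1 → ‖iteratedDeriv n (fun t : ℝ => f (y + t • v)) 0‖ ≤ C := by
  obtain ⟨τ, δ, hτ, hδ, H⟩ := exists_times_tolerances
  by_contra! hC
  have hz (k : ℕ) : ∃ z v, ‖z - x‖ ≤ δ k ∧ ‖v‖ ≤ 1 ∧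
      k / δ k ^ n < ‖iteratedDeriv n (fun t : ℝ => f (z + t • v)) 0‖ := by
    obtain ⟨z, hz, hzx⟩ := ((hC (k / δ k ^ n)).and_eventually
      (Metric.ball_mem_nhds x (hδ k))).exists
    obtain ⟨v, hv, hzv⟩ := hz
    rw [dist_eq_norm] at hzx
    exact ⟨z, v, hzx.le, hv, hzv⟩
  choose z v hzx hv hzv using hz
  -- The velocity `δ k • v k` costs a factor `δ k ^ n` in the derivative of order `n`, for which the
  -- choice of `z k` and `v k` makes up.
  obtain ⟨c, hc, hc0, hcz⟩ := H (fun k => z k - x) (fun k => δ k • v k) hzx (fun k => by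
    rw [norm_smul, Real.norm_of_nonneg (hδ k).le]
    exact mul_le_of_le_one_right (hδ k).le (hv k))
  have hfc : ContDiff ℝ ∞ (f ∘ fun t => x + c t) := hf _ (contDiff_const.add hc)
  have hlim := ((hfc.continuous_iteratedDeriv n (by exact_mod_cast le_top)).norm.tendsto 0).comp hτ
  have hbig (k : ℕ) : (k : ℝ) ≤ ‖iteratedDeriv n (f ∘ fun t => x + c t) (τ k)‖ := by
    have hline : ContDiff ℝ ∞ (fun t : ℝ => f (z k + t • v k)) :=
      hf _ (contDiff_const.add (contDiff_id.smul contDiff_const))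
    have e : (f ∘ fun t => x + c t) =ᶠ[𝓝 (τ k)]
        fun t => (fun s => (fun t : ℝ => f (z k + t • v k)) (δ k * s)) (t - τ k) := by
      filter_upwards [hcz k] with t ht
      simp only [Function.comp_apply, ht]
      congr 1
      rw [smul_smul, mul_comm (δ k)]
      abel
    rw [e.iteratedDeriv_eq, iteratedDeriv_comp_sub_const n
        (fun s => (fun t : ℝ => f (z k + t • v k)) (δ k * s)) (τ k),
      iteratedDeriv_comp_const_smul (hline.of_le (by exact_mod_cast le_top))]
    have hpos : 0 < δ k ^ n := pow_pos (hδ k) n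
    have := (div_lt_iff₀ hpos).1 (hzv k)
    simp only [sub_self, mul_zero, norm_smul, Real.norm_of_nonneg hpos.le]
    linarith
  exact not_tendsto_nhds_of_tendsto_atTop
    (tendsto_atTop_mono hbig tendsto_natCast_atTop_atTop) _ hlim

end Curves

end FSys

namespace FSys

open Filter Topology MeasureTheory
open scoped FourierTransform RealInnerProductSpace

/-! ### Smoothness from directional derivatives, by Fourier transform -/

section Fourier

variable {V : Type*} [NormedAddCommGroup V]

/-- The iterated differences of a smooth function of one variable are controlled by the
derivative of the same order. -/
theorem norm_fwdDiff_iter_le {W : Type*} [NormedAddCommGroup W] [NormedSpace ℝ W] {h : ℝ}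
    (hh : 0 ≤ h) (n : ℕ) :
    ∀ {g : ℝ → W} {C : ℝ}, ContDiff ℝ ∞ g → (∀ t, ‖iteratedDeriv n g t‖ ≤ C) →
      ∀ t, ‖(fwdDiff h)^[n] g t‖ ≤ C * h ^ n := by
  induction n with
  | zero => intro g C _ hC t; simpa using hC t
  | succ n ih =>
    intro g C hg hC t
    rw [Function.iterate_succ_apply, pow_succ', ← mul_assoc]
    have hshift : ContDiff ℝ ∞ (fun s => g (s + h)) := hg.comp (contDiff_id.add contDiff_const)
    have hle : ((n : ℕ) : ℕ∞ω) ≤ ∞ := by exact_mod_cast le_top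
    refine ih (hshift.sub hg) (fun s => ?_) t
    have e : iteratedDeriv n (fwdDiff h g) s = iteratedDeriv n g (s + h) - iteratedDeriv n g s := by
      have := iteratedDeriv_fun_sub (n := n) (x := s) (hshift.of_le hle).contDiffAt
        (hg.of_le hle).contDiffAt
      rw [iteratedDeriv_comp_add_const] at this
      exact this
    have hd : Differentiable ℝ (iteratedDeriv n g) :=
      hg.differentiable_iteratedDeriv n (by exact_mod_cast ENat.natCast_lt_top n)
    have := Convex.norm_image_sub_le_of_norm_deriv_le (s := Set.univ) (f := iteratedDeriv n g)
      (C := C) (fun x _ => hd x) (fun x _ => by rw [← iteratedDeriv_succ]; exact hC x) convex_univ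
      (Set.mem_univ s) (Set.mem_univ (s + h))
    refine (congrArg norm e).trans_le ?_
    simpa [abs_of_nonneg hh] using this

/-- Iterated differences in the direction of a line are iterated differences along that line. -/
theorem fwdDiff_iter_line [NormedSpace ℝ V] {W : Type*} [AddCommGroup W] (f : V → W) (x u : V)
    (h : ℝ) (n : ℕ) (t : ℝ) :
    (fwdDiff (h • u))^[n] f (x + t • u) = (fwdDiff h)^[n] (fun s => f (x + s • u)) t := by
  induction n generalizing t with
  | zero => simp
  | succ n ih =>
    rw [Function.iterate_succ_apply', Function.iterate_succ_apply']
    simp only [fwdDiff]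
    rw [← ih, ← ih, add_smul, add_assoc]

theorem fwdDiff_iter_eq_zero_of_lt_norm {W : Type*} [AddCommGroup W] {f : V → W} {R : ℝ}
    (hf : ∀ x, R < ‖x‖ → f x = 0) {v : V} (hv : ‖v‖ ≤ 1) (n : ℕ) :
    ∀ x, R + n < ‖x‖ → (fwdDiff v)^[n] f x = 0 := by
  induction n with
  | zero => simpa using hf
  | succ n ih =>
    intro x hx
    push_cast at hx
    rw [Function.iterate_succ_apply', fwdDiff]
    have := norm_sub_le (x + v) v
    rw [add_sub_cancel_right] at this
    rw [ih x (by linarith), ih (x + v) (by linarith), sub_zero]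

theorem continuous_fwdDiff_iter {W : Type*} [NormedAddCommGroup W] {f : V → W}
    (hf : Continuous f) (v : V) (n : ℕ) : Continuous ((fwdDiff v)^[n] f) := by
  induction n with
  | zero => simpa using hf
  | succ n ih =>
    rw [Function.iterate_succ_apply']
    exact (ih.comp (continuous_id.add continuous_const)).sub ih

variable [InnerProductSpace ℝ V] [FiniteDimensional ℝ V] [MeasurableSpace V] [BorelSpace V]

/-- At a frequency `w` with `⟪v, w⟫ = 1 / 2`, translation by `v` changes the sign of the Fourier
transform, so that taking the difference in the direction `v` multiplies it by `-2`. -/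
theorem fourier_fwdDiff {f : V → ℂ} (hf : Integrable f) {v w : V} (hvw : ⟪v, w⟫ = 1 / 2) :
    𝓕 (fwdDiff v f) w = (-2) * 𝓕 f w := by
  have hs : Integrable (fun x => f (x + v)) := hf.comp_add_right v
  have h1 : 𝓕 (fun x => f (x + v)) w = - 𝓕 f w := by
    have := congrFun (VectorFourier.fourierIntegral_comp_add_right Real.fourierChar volume
      (innerₗ V) f v) w
    refine this.trans ?_
    rw [Circle.smul_def, Real.fourierChar_apply]
    have e : (innerₗ V v) w = 1 / 2 := by simpa using hvw
    have e' : ((2 * Real.pi * (1 / 2) : ℝ) : ℂ) * Complex.I = Real.pi * Complex.I := by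
      push_cast; ring
    rw [e, e', Complex.exp_pi_mul_I]
    simp [Real.fourier_eq, VectorFourier.fourierIntegral]
  have h2 : 𝓕 (fwdDiff v f) w = 𝓕 (fun x => f (x + v)) w - 𝓕 f w := by
    simp only [Real.fourier_eq, fwdDiff, smul_sub]
    exact integral_sub ((Real.fourierIntegral_convergent_iff w).2 hs)
      ((Real.fourierIntegral_convergent_iff w).2 hf)
  rw [h2, h1]; ring

theorem fourier_fwdDiff_iter {f : V → ℂ} (hc : Continuous f) {R : ℝ}
    (hR : ∀ x, R < ‖x‖ → f x = 0) {v w : V} (hv : ‖v‖ ≤ 1) (hvw : ⟪v, w⟫ = 1 / 2) (n : ℕ) :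
    𝓕 ((fwdDiff v)^[n] f) w = (-2) ^ n * 𝓕 f w := by
  induction n with
  | zero => simp
  | succ n ih =>
    have hint : Integrable ((fwdDiff v)^[n] f) := by
      refine (continuous_fwdDiff_iter hc v n).integrable_of_hasCompactSupport
        (HasCompactSupport.intro (isCompact_closedBall (0 : V) (R + n)) fun x hx => ?_)
      exact fwdDiff_iter_eq_zero_of_lt_norm hR hv n x (by simpa using hx)
    rw [Function.iterate_succ_apply', fourier_fwdDiff hint hvw, ih, pow_succ]; ring

/-- The Fourier transform of a compactly supported function is rapidly decreasing as soon as all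
directional derivatives of the function are bounded: the iterated difference of order `n` with the
step `w / (2 ‖w‖²)` is of size `O(‖w‖⁻ⁿ)`, while it multiplies `𝓕 f w` by `(-2)ⁿ`. -/
theorem exists_pow_norm_mul_norm_fourier_le {f : V → ℂ} (hc : Continuous f)
    (hs : HasCompactSupport f)
    (hline : ∀ x v : V, ContDiff ℝ ∞ (fun t : ℝ => f (x + t • v))) (n : ℕ)
    (hb : ∃ C, ∀ x v : V, ‖v‖ ≤ 1 → ‖iteratedDeriv n (fun t : ℝ => f (x + t • v)) 0‖ ≤ C) :
    ∃ C, ∀ w, ‖w‖ ^ n * ‖𝓕 f w‖ ≤ C := by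
  obtain ⟨C, hC⟩ := hb
  obtain ⟨R, hR⟩ : ∃ R, ∀ x, R < ‖x‖ → f x = 0 := by
    obtain ⟨R, hR⟩ := hs.isCompact.isBounded.subset_closedBall (0 : V)
    refine ⟨R, fun x hx => ?_⟩
    by_contra h
    have := hR (subset_tsupport f h)
    rw [mem_closedBall_zero_iff] at this
    linarith
  have hC0 : 0 ≤ C := (norm_nonneg _).trans (hC 0 0 (by simp))
  let vol := volume.real (Metric.closedBall (0 : V) (R + n))
  refine ⟨max (∫ x, ‖f x‖) (C * vol), fun w => ?_⟩
  rcases le_or_gt ‖w‖ 1 with hw | hw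
  · refine le_max_of_le_left ?_
    calc ‖w‖ ^ n * ‖𝓕 f w‖ ≤ 1 * ‖𝓕 f w‖ := by
          gcongr; exact pow_le_one₀ (norm_nonneg _) hw
      _ ≤ ∫ x, ‖f x‖ := by
          rw [one_mul]
          exact VectorFourier.norm_fourierIntegral_le_integral_norm _ _ _ _ _
  · refine le_max_of_le_right ?_
    have hw0 : 0 < ‖w‖ := by linarith
    -- The step `h • u = w / (2 ‖w‖²)` has `⟪h • u, w⟫ = 1 / 2`, and `‖h • u‖ ≤ 1` keeps the
    -- differences supported in a ball independent of `w`.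
    let u : V := ‖w‖⁻¹ • w
    let h : ℝ := (2 * ‖w‖)⁻¹
    have hu : ‖u‖ = 1 := by
      rw [norm_smul, norm_inv, norm_norm, inv_mul_cancel₀ hw0.ne']
    have hh : 0 ≤ h := by positivity
    have hv : ‖h • u‖ ≤ 1 := by
      rw [norm_smul, hu, mul_one, Real.norm_of_nonneg hh]
      exact inv_le_one_of_one_le₀ (by linarith)
    have hvw : ⟪h • u, w⟫ = 1 / 2 := by
      simp only [u, h, real_inner_smul_left, real_inner_self_eq_norm_sq]
      field_simp
    have hF := fourier_fwdDiff_iter hc hR hv hvw n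
    have hpt (x : V) : ‖(fwdDiff (h • u))^[n] f x‖ ≤ C * h ^ n := by
      have e := fwdDiff_iter_line f x u h n 0
      rw [zero_smul, add_zero] at e
      rw [e]
      refine norm_fwdDiff_iter_le hh n (hline x u) (fun t => ?_) 0
      have := hC (x + t • u) u hu.le
      have e2 : (fun s : ℝ => f (x + t • u + s • u)) =
          fun s => (fun s : ℝ => f (x + s • u)) (t + s) := by
        ext s; simp only [add_smul, add_assoc]
      rw [e2, iteratedDeriv_comp_const_add n (fun s : ℝ => f (x + s • u)) t] at this
      simpa using this
    have hle : ‖𝓕 ((fwdDiff (h • u))^[n] f) w‖ ≤ C * h ^ n * vol := by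
      have h0 (x : V) (hx : x ∉ Metric.closedBall (0 : V) (R + n)) :
          Real.fourierChar (-⟪x, w⟫) • (fwdDiff (h • u))^[n] f x = 0 := by
        rw [fwdDiff_iter_eq_zero_of_lt_norm hR hv n x (by simpa using hx), smul_zero]
      rw [Real.fourier_eq, ← setIntegral_eq_integral_of_forall_compl_eq_zero h0]
      exact norm_setIntegral_le_of_norm_le_const measure_closedBall_lt_top
        fun x _ => by rw [Circle.norm_smul]; exact hpt x
    rw [hF, norm_mul, norm_pow, norm_neg, Complex.norm_ofNat] at hle
    have h2 : ‖w‖ ^ n * (2 ^ n * h ^ n) = 1 := by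
      rw [← mul_pow, ← mul_pow]
      convert one_pow n
      simp only [h]; field_simp
    calc ‖w‖ ^ n * ‖𝓕 f w‖ ≤ ‖w‖ ^ n * (2 ^ n * ‖𝓕 f w‖) := by
          gcongr; exact le_mul_of_one_le_left (norm_nonneg _) (one_le_pow₀ (by norm_num))
      _ ≤ ‖w‖ ^ n * (C * h ^ n * vol) := by gcongr
      _ ≤ ‖w‖ ^ n * (2 ^ n * (C * h ^ n * vol)) := by
          have h1 : (1 : ℝ) ≤ 2 ^ n := one_le_pow₀ (by norm_num)
          have h0 : 0 ≤ C * h ^ n * vol := by positivity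
          exact mul_le_mul_of_nonneg_left (le_mul_of_one_le_left h0 h1) (by positivity)
      _ = (‖w‖ ^ n * (2 ^ n * h ^ n)) * (C * vol) := by ring
      _ = C * vol := by rw [h2, one_mul]

/-- A compactly supported continuous function with bounded directional derivatives of all orders
is smooth: it is the inverse Fourier transform of a rapidly decreasing function. -/
theorem contDiff_of_bounded_iteratedDeriv_line {f : V → ℂ} (hc : Continuous f)
    (hs : HasCompactSupport f)
    (hline : ∀ x v : V, ContDiff ℝ ∞ (fun t : ℝ => f (x + t • v)))
    (hb : ∀ n, ∃ C, ∀ x v : V, ‖v‖ ≤ 1 → ‖iteratedDeriv n (fun t : ℝ => f (x + t • v)) 0‖ ≤ C) :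
    ContDiff ℝ ∞ f := by
  have hint : Integrable f := hc.integrable_of_hasCompactSupport hs
  have hFc : Continuous (𝓕 f) := VectorFourier.fourierIntegral_continuous
    Real.continuous_fourierChar (innerSL ℝ).continuous₂ hint
  have hdecay (n : ℕ) := exists_pow_norm_mul_norm_fourier_le hc hs hline n (hb n)
  have hF (n : ℕ) : Integrable (fun w => ‖w‖ ^ n * ‖𝓕 f w‖) := by
    obtain ⟨C₁, h₁⟩ := hdecay 0
    obtain ⟨C₂, h₂⟩ := hdecay (n + (volume : Measure V).integrablePower)
    exact integrable_of_le_of_pow_mul_le (fun w => by simpa using h₁ w) h₂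
      hFc.aestronglyMeasurable
  have hFint : Integrable (𝓕 f) :=
    (integrable_norm_iff hFc.aestronglyMeasurable).1 (by simpa using hF 0)
  have e : f = (𝓕 (𝓕 f)) ∘ fun x => -x := by
    ext x
    rw [Function.comp_apply, ← Real.fourierInv_eq_fourier_neg,
      hc.fourierInv_fourier_eq hint hFint]
  rw [e]
  exact (Real.contDiff_fourier (N := ⊤) fun n _ => hF n).comp contDiff_neg

end Fourier

end FSys

namespace FSys

open Filter Topology

/-! ### Boman's theorem -/

section Boman

variable {V : Type*} [NormedAddCommGroup V] [InnerProductSpace ℝ V] [FiniteDimensional ℝ V]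

/-- Boman's theorem for compactly supported complex-valued functions. -/
theorem contDiff_of_comp_curve_of_hasCompactSupport {f : V → ℂ} (hs : HasCompactSupport f)
    (hf : ∀ c : ℝ → V, ContDiff ℝ ∞ c → ContDiff ℝ ∞ (f ∘ c)) : ContDiff ℝ ∞ f := by
  have := FiniteDimensional.complete ℝ V
  borelize V
  have hc : Continuous f := continuous_iff_continuousAt.2 fun x =>
    continuousAt_of_comp_curve fun c hc _ => (hf c hc).continuous.continuousAt
  refine contDiff_of_bounded_iteratedDeriv_line hc hs
    (fun x v => hf _ (contDiff_const.add (contDiff_id.smul contDiff_const))) fun n => ?_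
  -- By compactness the local bounds give one bound on a closed ball containing the support; off
  -- this ball the directional derivatives vanish.
  obtain ⟨R, hR⟩ := hs.isCompact.isBounded.subset_closedBall (0 : V)
  have hloc (x : V) := eventually_norm_iteratedDeriv_line_le hf n x
  obtain ⟨C, hC⟩ : ∃ C, ∀ x ∈ Metric.closedBall (0 : V) R, ∀ v : V, ‖v‖ ≤ 1 →
      ‖iteratedDeriv n (fun t : ℝ => f (x + t • v)) 0‖ ≤ C := by
    refine (isCompact_closedBall (0 : V) R).induction_on (p := fun s => ∃ C, ∀ x ∈ s, ∀ v : V,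
      ‖v‖ ≤ 1 → ‖iteratedDeriv n (fun t : ℝ => f (x + t • v)) 0‖ ≤ C) ⟨0, by simp⟩
      (fun s t hst ⟨C, hC⟩ => ⟨C, fun x hx => hC x (hst hx)⟩) ?_ ?_
    · rintro s t ⟨C, hC⟩ ⟨D, hD⟩
      refine ⟨max C D, fun x hx v hv => ?_⟩
      rcases hx with hx | hx
      · exact le_max_of_le_left (hC x hx v hv)
      · exact le_max_of_le_right (hD x hx v hv)
    · intro x _
      obtain ⟨C, hC⟩ := hloc x
      exact ⟨_, mem_nhdsWithin_of_mem_nhds hC, C, fun y hy => hy⟩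
  refine ⟨max C 0, fun x v hv => ?_⟩
  by_cases hx : x ∈ Metric.closedBall (0 : V) R
  · exact le_max_of_le_left (hC x hx v hv)
  · refine le_max_of_le_right (le_of_eq ?_)
    have hcont : Tendsto (fun t : ℝ => x + t • v) (𝓝 0) (𝓝 x) := by
      have h : Continuous (fun t : ℝ => x + t • v) := by fun_prop
      simpa using h.tendsto 0
    have h0 : (fun t : ℝ => f (x + t • v)) =ᶠ[𝓝 0] fun _ => 0 := by
      filter_upwards [hcont (Metric.isClosed_closedBall.isOpen_compl.mem_nhds hx)] with t ht
      by_contra h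
      exact ht (hR (subset_tsupport f h))
    rw [h0.iteratedDeriv_eq]
    cases n <;> simp

/-- **Boman's theorem**, in local form: a map between Euclidean spaces which is smooth along the
smooth curves, as long as these run in a neighbourhood of `x`, is smooth at `x`. -/
theorem contDiffAt_of_comp_curve {m : ℕ} {f : V → EuclideanSpace ℝ (Fin m)} {Ω : Set V}
    (hΩ : IsOpen Ω)
    (hf : ∀ c : ℝ → V, ContDiff ℝ ∞ c → ∀ t, c t ∈ Ω → ContDiffAt ℝ ∞ (f ∘ c) t) {x : V}
    (hx : x ∈ Ω) : ContDiffAt ℝ ∞ f x := by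
  rw [contDiffAt_euclidean]
  intro i
  obtain ⟨r, hr, hrΩ⟩ := Metric.isOpen_iff.1 hΩ x hx
  let χ : ContDiffBump x := ⟨r / 4, r / 2, by positivity, by linarith⟩
  have hχΩ : tsupport χ ⊆ Ω := by
    rw [χ.tsupport_eq]
    exact (Metric.closedBall_subset_ball (by simp only [χ]; linarith)).trans hrΩ
  let g : V → ℂ := fun y => ((χ y * f y i : ℝ) : ℂ)
  have hg : ContDiff ℝ ∞ g := by
    refine contDiff_of_comp_curve_of_hasCompactSupport ?_ fun c hc => ?_
    · exact (χ.hasCompactSupport.mul_right (f' := fun y => f y i)).comp_left Complex.ofReal_zero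
    · refine Complex.ofRealCLM.contDiff.comp (contDiff_iff_contDiffAt.2 fun t => ?_)
      by_cases ht : c t ∈ tsupport χ
      · exact (χ.contDiff.comp hc).contDiffAt.mul
          (contDiffAt_euclidean.1 (hf c hc t (hχΩ ht)) i)
      · have h0 : (fun t => χ (c t) * f (c t) i) =ᶠ[𝓝 t] fun _ => 0 := by
          filter_upwards [hc.continuous.continuousAt
            ((isClosed_tsupport χ).isOpen_compl.mem_nhds ht)] with s hs
          rw [image_eq_zero_of_notMem_tsupport hs, zero_mul]
        exact contDiffAt_const.congr_of_eventuallyEq h0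
  have h1 : (fun y => f y i) =ᶠ[𝓝 x] fun y => (g y).re := by
    filter_upwards [χ.eventuallyEq_one] with y hy
    simp [g, hy]
  exact (Complex.reCLM.contDiff.comp hg).contDiffAt.congr_of_eventuallyEq h1

end Boman

section Manifold

variable {m n : ℕ} {M N : Type*}
  [TopologicalSpace M] [ChartedSpace (EuclideanSpace ℝ (Fin m)) M] [IsManifold (𝓡 m) ∞ M]
  [TopologicalSpace N] [ChartedSpace (EuclideanSpace ℝ (Fin n)) N] [IsManifold (𝓡 n) ∞ N]

/-- **Boman's theorem** for manifolds: a map which sends smooth curves to smooth curves is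
smooth. -/
theorem contMDiff_of_comp_curve {φ : M → N}
    (hφ : ∀ (J : Opens ℝ) (c : J → M), ContMDiff 𝓘(ℝ, ℝ) (𝓡 m) ∞ c →
      ContMDiff 𝓘(ℝ, ℝ) (𝓡 n) ∞ (φ ∘ c)) : ContMDiff (𝓡 m) (𝓡 n) ∞ φ := by
  intro x
  let ψ := extChartAt (𝓡 m) x
  have hψ : IsOpen ψ.target := isOpen_extChartAt_target x
  -- The hypothesis for curves in a chart of `M`.
  have key (c : ℝ → EuclideanSpace ℝ (Fin m)) (hc : ContDiff ℝ ∞ c) (t : ℝ)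
      (ht : c t ∈ ψ.target) : ContMDiffAt 𝓘(ℝ, ℝ) (𝓡 n) ∞ ((φ ∘ ψ.symm) ∘ c) t := by
    let J : Opens ℝ := ⟨c ⁻¹' ψ.target, hψ.preimage hc.continuous⟩
    have h : ContMDiff 𝓘(ℝ, ℝ) (𝓡 m) ∞ (fun s : J => ψ.symm (c s)) := fun s =>
      contMDiffAt_subtype_iff.2 (((contMDiffOn_extChartAt_symm x).contMDiffAt
        (hψ.mem_nhds s.2)).comp (s : ℝ) hc.contMDiff.contMDiffAt)
    exact contMDiffAt_subtype_iff (f := (φ ∘ ψ.symm) ∘ c) (x := ⟨t, ht⟩).1 (hφ J _ h ⟨t, ht⟩)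
  have hcont (z : EuclideanSpace ℝ (Fin m)) (hz : z ∈ ψ.target) :
      ContinuousAt (φ ∘ ψ.symm) z :=
    continuousAt_of_comp_curve fun c hc hc0 => (key c hc 0 (hc0 ▸ hz)).continuousAt
  have hx : ψ x ∈ ψ.target := mem_extChartAt_target x
  have hxx : ψ.symm (ψ x) = x := extChartAt_to_inv x
  let η := extChartAt (𝓡 n) (φ x)
  let Ω : Set (EuclideanSpace ℝ (Fin m)) := ψ.target ∩ (φ ∘ ψ.symm) ⁻¹' η.source
  have hΩ : IsOpen Ω := ContinuousOn.isOpen_inter_preimage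
    (fun z hz => (hcont z hz).continuousWithinAt) hψ (isOpen_extChartAt_source (φ x))
  have hxΩ : ψ x ∈ Ω := ⟨hx, by
    simp only [Set.mem_preimage, Function.comp_apply, hxx]; exact mem_extChartAt_source (φ x)⟩
  rw [contMDiffAt_iff]
  refine ⟨?_, ?_⟩
  · have h := ContinuousAt.comp (x := x) (hcont (ψ x) hx) (continuousAt_extChartAt x)
    refine h.congr ?_
    filter_upwards [extChartAt_source_mem_nhds (I := 𝓡 m) x] with y hy
    simp only [Function.comp_apply]
    rw [ψ.left_inv hy]
  · refine ContDiffAt.contDiffWithinAt ?_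
    refine contDiffAt_of_comp_curve hΩ (fun c hc t ht => ?_) hxΩ
    have h := (contMDiffAt_extChartAt' (I := 𝓡 n) (n := ∞) (x := φ x) (x' := φ (ψ.symm (c t)))
      (by rw [← extChartAt_source (𝓡 n)]; exact ht.2)).comp t (key c hc t ht.1)
    exact h.contDiffAt

end Manifold

end FSys

namespace FSys

/-! ### Smooth tubelike sections and F-smooth sections -/

section Comparison

variable {dB dF dG : ℕ} {B F G S : Type u}
  [TopologicalSpace B] [ChartedSpace (EuclideanSpace ℝ (Fin dB)) B] [IsManifold (𝓡 dB) ∞ B]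
  [TopologicalSpace F] [ChartedSpace (EuclideanSpace ℝ (Fin dF)) F] [IsManifold (𝓡 dF) ∞ F]
  [TopologicalSpace G] [ChartedSpace (EuclideanSpace ℝ (Fin dG)) G] [IsManifold (𝓡 dG) ∞ G]
  {p : FibredManifold (𝓡 dF) (𝓡 dB) F B} {q : FibredManifold (𝓡 dG) (𝓡 dF) G F}
  (sys : FSmoothSystem p q S)

/-- A section which induces a smooth tubelike section `φ` is F-smooth: along a curve `c` in `U` the
evaluation map on `c^*(F)` is the restriction of `(t, f) ↦ φ f`. -/
theorem isFSmooth_of_contMDiff [Nonempty B] {U : Opens B} (σ : sys.uSec.obj (op U))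
    (h : ContMDiff (𝓡 dF) (𝓡 dG) ∞ (sys.evalS.app (op U) σ).1) : sys.IsFSmooth σ := by
  classical
  intro J c hc hU
  have hζ : sys.ζ ∘ (fun t => σ.1 ⟨c t, hU t⟩) = c := funext fun t => σ.2 ⟨c t, hU t⟩
  refine ⟨by rw [hζ]; exact hc, ?_⟩
  rintro ⟨⟨t₀, f₀⟩, hx⟩
  let φ : p.tube U → G := (sys.evalS.app (op U) σ).1
  -- Off `p⁻¹(U)` an arbitrary value is taken.
  let g' : J × F → G := fun z => if hz : z.2 ∈ p.tube U then φ ⟨z.2, hz⟩ else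
    sys.ε ⟨(σ.1 ⟨c t₀, hU t₀⟩, f₀), hx⟩
  have hp (t : J) (f : F) (hf : sys.ζ (σ.1 ⟨c t, hU t⟩) = p f) : p f = c t :=
    hf.symm.trans (congrFun hζ t)
  refine ⟨Prod.snd ⁻¹' (p.tube U : Set F), (p.tube U).isOpen.preimage continuous_snd, ?_, g',
    ?_, ?_⟩
  · change p f₀ ∈ U
    rw [hp t₀ f₀ hx]; exact hU t₀
  · have hg : ContMDiffOn (𝓡 dF) (𝓡 dG) ∞ (fun f : F => g' (t₀, f)) (p.tube U) := by
      intro f hf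
      have h1 : ContMDiffAt (𝓡 dF) (𝓡 dG) ∞ (fun y : p.tube U => g' (t₀, (y : F))) ⟨f, hf⟩ := by
        have e : (fun y : p.tube U => g' (t₀, (y : F))) = φ := by
          funext y
          simp only [g', dif_pos y.2]
        rw [e]
        exact h ⟨f, hf⟩
      exact (contMDiffAt_subtype_iff (f := fun f : F => g' (t₀, f))
        (x := (⟨f, hf⟩ : p.tube U)).1 h1).contMDiffWithinAt
    exact hg.comp contMDiffOn_snd fun _ hz => hz
  · rintro ⟨⟨t, f⟩, hy⟩ hf
    have e : (⟨p f, hf⟩ : U) = ⟨c t, hU t⟩ := Subtype.ext (hp t f hy)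
    have e2 : g' (t, f) = φ ⟨f, hf⟩ := dif_pos hf
    change g' (t, f) = sys.ε ⟨(σ.1 ⟨c t, hU t⟩, f), hy⟩
    rw [e2]
    change sys.ε ⟨(σ.1 ⟨p f, hf⟩, f), _⟩ = _
    simp only [e]

/-- An F-smooth section `σ` induces a smooth tubelike section: by Boman's theorem smoothness can be
tested on the curves `γ` in `p⁻¹(U)`, and along `γ` the tubelike section is the composition of the
smooth curve `(t, γ t)` in `c^*(F)`, where `c = p ∘ γ`, with the evaluation map of the basic curve
`σ ∘ c`. -/
theorem contMDiff_of_isFSmooth [Nonempty B] {U : Opens B} (σ : sys.uSec.obj (op U))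
    (h : sys.IsFSmooth σ) : ContMDiff (𝓡 dF) (𝓡 dG) ∞ (sys.evalS.app (op U) σ).1 := by
  refine contMDiff_of_comp_curve fun J γ hγ => ?_
  have hγF : ContMDiff 𝓘(ℝ, ℝ) (𝓡 dF) ∞ (fun t => (γ t : F)) := contMDiff_subtype_val.comp hγ
  have hU (t : J) : p (γ t) ∈ U := (γ t).2
  obtain ⟨-, h2⟩ := h J (fun t => p (γ t)) (p.isSubmersion.contMDiff.comp hγF) hU
  intro t₀
  obtain ⟨W, hW, h0W, g', hg', hgg⟩ := h2 ⟨(t₀, (γ t₀ : F)), σ.2 ⟨p (γ t₀), hU t₀⟩⟩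
  have hgraph : ContMDiff 𝓘(ℝ, ℝ) (𝓘(ℝ, ℝ).prod (𝓡 dF)) ∞ (fun t : J => (t, (γ t : F))) :=
    contMDiff_id.prodMk hγF
  have hcomp : ContMDiffAt 𝓘(ℝ, ℝ) (𝓡 dG) ∞ (g' ∘ fun t : J => (t, (γ t : F))) t₀ :=
    ContMDiffAt.comp (I' := 𝓘(ℝ, ℝ).prod (𝓡 dF)) t₀ (hg'.contMDiffAt (hW.mem_nhds h0W))
      hgraph.contMDiffAt
  refine hcomp.congr_of_eventuallyEq ?_
  filter_upwards [hgraph.continuous.continuousAt (hW.mem_nhds h0W)] with t ht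
  exact (hgg ⟨(t, (γ t : F)), σ.2 ⟨p (γ t), hU t⟩⟩ ht).symm

theorem contMDiff_evalS_iff_isFSmooth [Nonempty B] {U : Opens B} (σ : sys.uSec.obj (op U)) :
    ContMDiff (𝓡 dF) (𝓡 dG) ∞ (sys.evalS.app (op U) σ).1 ↔ sys.IsFSmooth σ :=
  ⟨isFSmooth_of_contMDiff sys σ, contMDiff_of_isFSmooth sys σ⟩

/-! ### The sheaf conditions -/

/-- Smoothness of a map on a tube is local with respect to the base. -/
theorem contMDiff_tube_iSup {ι : Type*} {U : ι → Opens B}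
    (φ : p.tube (iSup U) → G)
    (h : ∀ i, ContMDiff (𝓡 dF) (𝓡 dG) ∞
      (fun f : p.tube (U i) => φ ⟨f, Opens.mem_iSup.2 ⟨i, f.2⟩⟩)) :
    ContMDiff (𝓡 dF) (𝓡 dG) ∞ φ := by
  classical
  rintro ⟨f, hf⟩
  obtain ⟨i, hi⟩ := Opens.mem_iSup.1 hf
  -- A (non-smooth) extension of `φ` to `F` makes the restrictions comparable.
  let φ' : F → G := fun f' => if h' : f' ∈ p.tube (iSup U) then φ ⟨f', h'⟩ else φ ⟨f, hf⟩
  have e1 : φ = fun f' : p.tube (iSup U) => φ' f' := by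
    funext f'
    simp only [φ', dif_pos f'.2]
  have e2 : (fun f' : p.tube (U i) => φ ⟨f', Opens.mem_iSup.2 ⟨i, f'.2⟩⟩) =
      fun f' : p.tube (U i) => φ' f' := by
    funext f'
    have : (f' : F) ∈ p.tube (iSup U) := Opens.mem_iSup.2 ⟨i, f'.2⟩
    simp only [φ', dif_pos this]
  have h1 := h i ⟨f, hi⟩
  rw [e2, contMDiffAt_subtype_iff] at h1
  rw [e1, contMDiffAt_subtype_iff]
  exact h1

/-- A compatible family of sections of `ζ` has a unique gluing. -/
theorem existsUnique_gluing_uSec {ι : Type u} (U : ι → Opens B)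
    (sf : ∀ i, sys.uSec.obj (op (U i)))
    (hsf : ∀ i j (b : B) (hi : b ∈ U i) (hj : b ∈ U j), (sf i).1 ⟨b, hi⟩ = (sf j).1 ⟨b, hj⟩) :
    ∃! s : sys.uSec.obj (op (iSup U)),
      ∀ i (b : B) (hi : b ∈ U i), s.1 ⟨b, Opens.mem_iSup.2 ⟨i, hi⟩⟩ = (sf i).1 ⟨b, hi⟩ := by
  choose k hk using fun b : ↥(iSup U) => Opens.mem_iSup.1 b.2
  refine ⟨⟨fun b => (sf (k b)).1 ⟨b, hk b⟩, fun b => (sf (k b)).2 ⟨b, hk b⟩⟩,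
    fun i b hi => hsf _ _ b _ hi, fun s hs => ?_⟩
  apply Subtype.ext
  funext b
  exact hs (k b) b (hk b)

theorem isSheaf_fSec [Nonempty B] :
    TopCat.Presheaf.IsSheaf (X := TopCat.of B) sys.fSec.toFunctor := by
  refine TopCat.Presheaf.isSheaf_of_isSheafUniqueGluing_types _ fun ι U sf hsf => ?_
  obtain ⟨s, hs, hu⟩ := existsUnique_gluing_uSec sys U (fun i => (sf i).1)
    (fun i j b hi hj => congrFun (congrArg (fun z => z.1.1) (hsf i j)) ⟨b, hi, hj⟩)
  have hsF : sys.IsFSmooth s := by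
    refine (contMDiff_evalS_iff_isFSmooth sys s).1 (contMDiff_tube_iSup _ fun i => ?_)
    have h := (contMDiff_evalS_iff_isFSmooth sys (sf i).1).2 (sf i).2
    refine h.congr fun f => ?_
    have e := hs i (p f) f.2
    change sys.ε ⟨(s.1 ⟨p f, _⟩, f), _⟩ = sys.ε ⟨((sf i).1.1 ⟨p f, _⟩, f), _⟩
    simp only [e]
  refine ⟨⟨s, hsF⟩, fun i => ?_, fun s' hs' => ?_⟩
  · apply Subtype.ext
    apply Subtype.ext
    funext b
    exact hs i b b.2
  · apply Subtype.ext
    exact hu s'.1 fun i b hi => congrFun (congrArg (fun z => z.1.1) (hs' i)) ⟨b, hi⟩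

/-- The tubelike smooth sections selected by the system form a sheaf. The sections of `ζ` which
induce the members of a compatible family need not be compatible, but since they are not required
to be smooth, a section inducing the gluing can be chosen among them at each point separately. -/
theorem isSheaf_tubS :
    TopCat.Presheaf.IsSheaf (X := TopCat.of B) sys.tubS.toFunctor := by
  refine TopCat.Presheaf.isSheaf_of_isSheafUniqueGluing_types _ fun ι U sf hsf => ?_
  have hcompat (i j : ι) (f : F) (hi : p f ∈ U i) (hj : p f ∈ U j) :
      (sf i).1.1 ⟨f, hi⟩ = (sf j).1.1 ⟨f, hj⟩ :=
    congrFun (congrArg (fun z => z.1.1) (hsf i j)) ⟨f, hi, hj⟩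
  have hrange (i : ι) : ∃ σ, sys.evalS.app (op (U i)) σ = (sf i).1 := (sf i).2.1
  choose σ hσ using hrange
  choose k hk using fun b : ↥(iSup U) => Opens.mem_iSup.1 b.2
  let τ : sys.uSec.obj (op (iSup U)) :=
    ⟨fun b => (σ (k b)).1 ⟨b, hk b⟩, fun b => (σ (k b)).2 ⟨b, hk b⟩⟩
  have hτ (i : ι) (f : F) (hi : p f ∈ U i) :
      (sys.evalS.app (op (iSup U)) τ).1 ⟨f, Opens.mem_iSup.2 ⟨i, hi⟩⟩ = (sf i).1.1 ⟨f, hi⟩ := by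
    have hf : p f ∈ iSup U := Opens.mem_iSup.2 ⟨i, hi⟩
    rw [hcompat i (k ⟨p f, hf⟩) f hi (hk _), ← hσ]
    rfl
  have hsmooth : ContMDiff (𝓡 dF) (𝓡 dG) ∞ (sys.evalS.app (op (iSup U)) τ).1 := by
    refine contMDiff_tube_iSup _ fun i => ?_
    have h : ContMDiff (𝓡 dF) (𝓡 dG) ∞ (sf i).1.1 := (sf i).2.2
    exact h.congr fun f => hτ i f f.2
  refine ⟨⟨sys.evalS.app (op (iSup U)) τ, ⟨τ, rfl⟩, hsmooth⟩, fun i => ?_, fun s hs => ?_⟩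
  · apply Subtype.ext
    apply Subtype.ext
    funext f
    exact hτ i f f.2
  · apply Subtype.ext
    apply Subtype.ext
    funext f
    obtain ⟨i, hi⟩ := Opens.mem_iSup.1 f.2
    exact (congrFun (congrArg (fun z => z.1.1) (hs i)) ⟨f, hi⟩).trans (hτ i f hi).symm

/-- The evaluation morphism, from F-smooth sections to selected tubelike smooth sections. -/
noncomputable def evalSmooth [Nonempty B] : sys.fSec.toFunctor ⟶ sys.tubS.toFunctor :=
  Subfunctor.lift (sys.fSec.ι ≫ sys.evalS) (by
    rintro U _ ⟨σ, rfl⟩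
    exact ⟨⟨σ.1, rfl⟩, (contMDiff_evalS_iff_isFSmooth sys (U := unop U) σ.1).2 σ.2⟩)

theorem surjective_evalSmooth_app [Nonempty B] (U : Opens B) :
    Function.Surjective ((evalSmooth sys).app (op U)) := by
  rintro ⟨_, ⟨σ, rfl⟩, hσ⟩
  exact ⟨⟨σ, (contMDiff_evalS_iff_isFSmooth sys σ).1 hσ⟩, rfl⟩

theorem isIso_evalSmooth [Nonempty B] (h : sys.Injective) : IsIso (evalSmooth sys) := by
  have (U : (Opens (TopCat.of B))ᵒᵖ) : IsIso ((evalSmooth sys).app U) := by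
    rw [isIso_iff_bijective]
    refine ⟨fun σ σ' e => ?_, surjective_evalSmooth_app sys (unop U)⟩
    exact Subtype.ext (h (unop U) (congrArg Subtype.val e))
  exact NatIso.isIso_of_isIso_app _

end Comparison

end FSys

theorem mainTheorem1
    {dB dF dG : ℕ} {B F G S : Type u} [Nonempty B]
    [TopologicalSpace B] [ChartedSpace (EuclideanSpace ℝ (Fin dB)) B] [IsManifold (𝓡 dB) ∞ B]
    [TopologicalSpace F] [ChartedSpace (EuclideanSpace ℝ (Fin dF)) F] [IsManifold (𝓡 dF) ∞ F]
    [TopologicalSpace G] [ChartedSpace (EuclideanSpace ℝ (Fin dG)) G] [IsManifold (𝓡 dG) ∞ G]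
    (p : FSys.FibredManifold (𝓡 dF) (𝓡 dB) F B) (q : FSys.FibredManifold (𝓡 dG) (𝓡 dF) G F)
    (sys : FSys.FSmoothSystem p q S) :
    (∀ (U : Opens B) (σ : sys.uSec.obj (op U)),
      ContMDiff (𝓡 dF) (𝓡 dG) ∞ (sys.evalS.app (op U) σ).1 ↔ sys.IsFSmooth σ) ∧
    TopCat.Presheaf.IsSheaf (X := TopCat.of B) sys.fSec.toFunctor ∧
    TopCat.Presheaf.IsSheaf (X := TopCat.of B) sys.tubS.toFunctor ∧
    ∃ e : sys.fSec.toFunctor ⟶ sys.tubS.toFunctor,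
      e ≫ sys.tubS.ι = sys.fSec.ι ≫ sys.evalS ∧
      (∀ U : Opens B, Function.Surjective (e.app (op U))) ∧
      (sys.Injective → IsIso e) := by
  exact ⟨fun _ σ => FSys.contMDiff_evalS_iff_isFSmooth sys σ, FSys.isSheaf_fSec sys,
    FSys.isSheaf_tubS sys, FSys.evalSmooth sys, rfl, FSys.surjective_evalSmooth_app sys,
    FSys.isIso_evalSmooth sys⟩
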